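/- Let $d\ge 1$ be a fixed integer. Let $\mathcal H$ be a $d$-uniform hypergraph with known finite vertex set $U$ and unknown set $\mathcal F$ of hyperedges. A GPISE oracle for $\mathcal H$ takes as input $d$ pairwise disjoint non-empty sets $A_1,\dots,A_d\subseteq U$; it returns some hyperedge $\{u_1,\dots,u_d\}\in\mathcal F$ with $u_i\in A_i$ for all $i$ if there is one (which one is arbitrary), and NULL otherwise. In $d$-Promised-Hitting-Set one is given $U$, a positive integer $k$ and access to a GPISE oracle for $\mathcal H$, with the promise that a minimum hitting set of $\mathcal H$ has at most $k$ vertices; the task is to output a hitting set of $\mathcal H$ with at most $k$ vertices. For positive integers $t,b$ consider the following randomized algorithm. Choose $t$ independent colorings $h_1,\dots,h_t:U\to\{1,\dots,b\}$, where each $h_r$ colors every vertex uniformly and independently. For each $r$, ask the oracle the query $(U_{i_1},\dots,U_{i_d})$, where $U_i=h_r^{-1}(i)$, for all $1\le i_1<\dots<i_d\le b$ for which all these color classes are non-empty, and let $\mathcal H_r$ be the hypergraph on $U$ whose hyperedges are those returned. Output a minimum hitting set of $\hat{\mathcal H}=\mathcal H_1\cup\dots\cup\mathcal H_t$. (If $t=0$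 then $\hat{\mathcal H}$ has no hyperedges.) **Theorem.** For every $d\ge1$ and every constant $c>0$ there are constants $\alpha,\beta,C$, depending only on $d$ and $c$, such that for every integer $k\ge 1$ and every finite vertex set $U$ the above algorithm with $t=\lceil\alpha\log k\rceil$ samples and $b=\beta k$ colors (and any rule for choosing among the minimum hitting sets of $\hat{\mathcal H}$) has the following two properties. 1. It always makes at most $C\,k^d\log k$, that is $\widetilde{O}(k^d)$, GPISE queries. 2. For every $d$-uniform hypergraph $\mathcal H$ on $U$ that has a hitting set of size at most $k$, and every GPISE oracle for $\mathcal H$, with probability at least $1-1/k^{c}$ the output is a minimum hitting set of $\mathcal H$ (so it solves $d$-Promised-Hitting-Set). -/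

import Mathlib

/-- `S` is a hitting set of the set system `𝓕`: it meets every hyperedge. -/
def IsHittingSet {V : Type*} [DecidableEq V] (𝓕 : Finset (Finset V)) (S : Finset V) : Prop :=
  ∀ e ∈ 𝓕, (e ∩ S).Nonempty

/-- `S` is a hitting set of `𝓕` of minimum cardinality. -/
def IsMinHittingSet {V : Type*} [DecidableEq V] (𝓕 : Finset (Finset V)) (S : Finset V) : Prop :=
  IsHittingSet 𝓕 S ∧ ∀ T : Finset V, IsHittingSet 𝓕 T → S.card ≤ T.card

/-- An offline solver: given an explicitly known set system that has a hitting set (equivalently,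
that does not have the empty hyperedge), it returns some minimum hitting set of it. -/
def IsHittingSetSolver {V : Type*} [DecidableEq V]
    (solve : Finset (Finset V) → Finset V) : Prop :=
  ∀ 𝓖 : Finset (Finset V), ∅ ∉ 𝓖 → IsMinHittingSet 𝓖 (solve 𝓖)

/-- Offline solvers exist. -/
theorem exists_isHittingSetSolver (V : Type*) [Fintype V] [DecidableEq V] :
    ∃ solve : Finset (Finset V) → Finset V, IsHittingSetSolver solve := by
  classical
  have key : ∀ 𝓖 : Finset (Finset V), ∃ S : Finset V, ∅ ∉ 𝓖 → IsMinHittingSet 𝓖 S := by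
    intro 𝓖
    by_cases h : ∅ ∈ 𝓖
    · exact ⟨∅, fun h' => absurd h h'⟩
    · have hne : (Finset.univ.filter fun S : Finset V => IsHittingSet 𝓖 S).Nonempty := by
        refine ⟨Finset.univ, ?_⟩
        simp only [Finset.mem_filter, Finset.mem_univ, true_and]
        intro e he
        rw [Finset.inter_univ]
        exact Finset.nonempty_iff_ne_empty.2 fun h0 => h (h0 ▸ he)
      obtain ⟨S, hS, hmin⟩ := Finset.exists_min_image _ Finset.card hne
      refine ⟨S, fun _ => ⟨(Finset.mem_filter.1 hS).2, fun T hT => hmin T ?_⟩⟩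
      exact Finset.mem_filter.2 ⟨Finset.mem_univ _, hT⟩
  choose solve hsolve using key
  exact ⟨solve, hsolve⟩

/-- A legal GPISE query: `d` pairwise disjoint non-empty sets of vertices. -/
structure GPISEQuery (V : Type*) (d : ℕ) where
  part : Fin d → Finset V
  nonempty : ∀ i, (part i).Nonempty
  disjoint : ∀ i j, i ≠ j → Disjoint (part i) (part j)

/-- The hyperedge `e` is `{u₁, …, u_d}` with `u_i` in the `i`-th part of the query. -/
def GPISEQuery.Crosses {V : Type*} [DecidableEq V] {d : ℕ} (q : GPISEQuery V d)
    (e : Finset V) : Prop :=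
  ∃ u : Fin d → V, (∀ i, u i ∈ q.part i) ∧ Finset.univ.image u = e

/-- A rule answering queries by a vertex set or by NULL (which is `none`). -/
abbrev GPISEResponder (V : Type*) (d : ℕ) := GPISEQuery V d → Option (Finset V)

/-- `O` is a GPISE oracle for the hypergraph with hyperedges `𝓕`: it answers with an arbitrary
hyperedge crossing the query if there is one, and with NULL otherwise. -/
structure IsGPISEOracle {V : Type*} [DecidableEq V] {d : ℕ} (𝓕 : Finset (Finset V))
    (O : GPISEResponder V d) : Prop where
  of_some : ∀ q e, O q = some e → e ∈ 𝓕 ∧ q.Crosses e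
  of_none : ∀ q, O q = none → ∀ e ∈ 𝓕, ¬ q.Crosses e

/-- Deterministic adaptive query algorithms (decision trees) with output in `R`: stop with an
output, or ask a query and continue depending on the answer. -/
inductive QueryAlg (V : Type*) (d : ℕ) (R : Type*) where
  | done (r : R) : QueryAlg V d R
  | ask (q : GPISEQuery V d) (next : Option (Finset V) → QueryAlg V d R) : QueryAlg V d R

namespace QueryAlg

/-- Run the first algorithm, then continue with its output. -/
def bind {V : Type*} {d : ℕ} {R R' : Type*} :
    QueryAlg V d R → (R → QueryAlg V d R') → QueryAlg V d R'
  | done r, f => f r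
  | ask q next, f => ask q fun a => (next a).bind f

/-- The output when the queries are answered by `O`. -/
def output {V : Type*} {d : ℕ} {R : Type*} (O : GPISEResponder V d) : QueryAlg V d R → R
  | done r => r
  | ask q next => (next (O q)).output O

/-- The number of queries asked when the queries are answered by `O`. -/
def numQueries {V : Type*} {d : ℕ} {R : Type*} (O : GPISEResponder V d) : QueryAlg V d R → ℕ
  | done _ => 0
  | ask q next => (next (O q)).numQueries O + 1

/-- Ask all the queries of a list and return the set of hyperedges received. -/
def collect {V : Type*} [DecidableEq V] {d : ℕ} :
    List (GPISEQuery V d) → QueryAlg V d (Finset (Finset V))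
  | [] => done ∅
  | q :: qs => ask q fun a => (collect qs).bind fun 𝓖 => done (a.toFinset ∪ 𝓖)

end QueryAlg

/-- A randomized query algorithm: a random decision tree. -/
abbrev RandQueryAlg (V : Type*) (d : ℕ) (R : Type*) := PMF (QueryAlg V d R)

/-- The probability that the output of `A`, run with the responder `O`, satisfies `P`. -/
noncomputable def RandQueryAlg.prob {V : Type*} {d : ℕ} {R : Type*} (A : RandQueryAlg V d R)
    (O : GPISEResponder V d) (P : R → Prop) : ℝ :=
  ((A.map (QueryAlg.output O)).toOuterMeasure {r | P r}).toReal

/-- The vertices that get the color `i` under `h`. -/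
def colorClass {V : Type*} [Fintype V] {b : ℕ} (h : V → Fin b) (i : Fin b) : Finset V :=
  Finset.univ.filter fun v => h v = i

/-- Increasing `d`-tuples of colors of `h` whose color classes are all non-empty. -/
def ColorTuple {V : Type*} [Fintype V] (d : ℕ) {b : ℕ} (h : V → Fin b) : Type :=
  {s : Fin d → Fin b // StrictMono s ∧ ∀ j, (colorClass h (s j)).Nonempty}

noncomputable instance {V : Type*} [Fintype V] (d : ℕ) {b : ℕ} (h : V → Fin b) :
    Fintype (ColorTuple d h) := by
  classical
  unfold ColorTuple
  infer_instance

/-- The query whose parts are the color classes of an increasing tuple of colors. -/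
def colorQuery {V : Type*} [Fintype V] {d b : ℕ} (h : V → Fin b) (s : ColorTuple d h) :
    GPISEQuery V d where
  part j := colorClass h (s.1 j)
  nonempty := s.2.2
  disjoint i j hij := by
    rw [Finset.disjoint_left]
    intro v hi hj
    have hi' := (Finset.mem_filter.1 hi).2
    have hj' := (Finset.mem_filter.1 hj).2
    exact hij (s.2.1.injective (hi'.symm.trans hj'))

/-- The sampling primitive for a coloring `h`: ask the query `(U_{i₁}, …, U_{i_d})` for all
`i₁ < ⋯ < i_d` whose color classes are non-empty, and return the hyperedges received. -/
noncomputable def colorSample {V : Type*} [Fintype V] [DecidableEq V] (d : ℕ) {b : ℕ}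
    (h : V → Fin b) : QueryAlg V d (Finset (Finset V)) :=
  QueryAlg.collect ((Finset.univ : Finset (ColorTuple d h)).toList.map (colorQuery h))

/-- Sample with each of the given colorings and return the union of the samples. -/
noncomputable def unionOfSamples {V : Type*} [Fintype V] [DecidableEq V] (d : ℕ) {b : ℕ} :
    List (V → Fin b) → QueryAlg V d (Finset (Finset V))
  | [] => QueryAlg.done ∅
  | h :: hs => (colorSample d h).bind fun 𝓖 =>
      (unionOfSamples d hs).bind fun 𝓖' => QueryAlg.done (𝓖 ∪ 𝓖')

/-- The randomized algorithm: choose `t` independent uniformly random colorings with `b` colors,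
take the union of the `t` samples, and return the minimum hitting set that `solve` finds for it. -/
noncomputable def colorCodingAlg {V : Type*} [Fintype V] [DecidableEq V] (d t : ℕ) (b : ℕ+)
    (solve : Finset (Finset V) → Finset V) : RandQueryAlg V d (Finset V) :=
  (PMF.uniformOfFintype (Fin t → V → Fin b)).map fun h =>
    (unionOfSamples d (List.ofFn h)).bind fun 𝓖 => QueryAlg.done (solve 𝓖)

/-!
For a hyperedge `e` and a set `C ⊆ e`, call `e \ C` the petal of `e` at `C`. For every `C`, either
there are `N` hyperedges with pairwise disjoint petals at `C` (a sunflower), or at most `d N`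
vertices meet all the petals at `C` (`hasSunflower_or_exists_cover`). Require
`N j = B ^ (j + 1) * k` petals of a core with `j` vertices, with `B` large in terms of `d`, and
consider the inclusion-minimal cores of such sunflowers. Every hyperedge is itself a core, its
petals being empty, so it contains a minimal core; and since the proper subsets of a minimal core
`C` have covers of size `O(k)`, each with a further vertex of `C`, branching over these covers shows
that there are only `O(k) ^ d` minimal cores (`exists_finset_isMinimalCore`).

One sample forces a given minimal core `C` with probability at least `1/2`, in the sense that every
set of at most `k` vertices hitting the sample meets `C`
(`IsMinimalCore.card_filter_not_forces_le`). Indeed there are `O(k)` vertices outside `C`, forming a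
set `X`, that meet all the hyperedges not containing `C`. As there are `b = β k` colors, with
probability at least `1/2` the coloring gives the vertices of `C`, and those of more than half of
the petals of the sunflower, colors that occur nowhere else among `C`, `X` and the petals. If the
colors of such a petal avoid those of `X`, the answer to the query made of the colors of `C` and of
the petal is a hyperedge containing `C`. A set of at most `k` vertices disjoint from `C` has too few
colors to hit all these answers (`forces_colorSample`).

After `t = ⌈α log k⌉` independent samples a fixed minimal core is not forced with probability at
most `2 ^ (-t)`, and a union bound over the `O(k) ^ d` minimal cores gives total failure probability
at most `1 / k ^ c`. When all minimal cores are forced, a minimum hitting set of the union of the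
samples, having at most `k` elements by the promise, meets every minimal core, hence every hyperedge
(`IsMinHittingSet.of_forces`).
-/

/-! ### Query algorithms: outputs and numbers of queries -/

namespace QueryAlg

variable {V : Type*} {d : ℕ} {R R' : Type*}

theorem output_bind (O : GPISEResponder V d) (A : QueryAlg V d R) (f : R → QueryAlg V d R') :
    (A.bind f).output O = (f (A.output O)).output O := by
  induction A with
  | done r => rfl
  | ask q next ih => exact ih (O q)

theorem numQueries_bind (O : GPISEResponder V d) (A : QueryAlg V d R)
    (f : R → QueryAlg V d R') :
    (A.bind f).numQueries O = A.numQueries O + (f (A.output O)).numQueries O := by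
  induction A with
  | done r => simp [bind, numQueries, output]
  | ask q next ih => simp only [bind, numQueries, output, ih (O q)]; omega

theorem mem_output_collect [DecidableEq V] (O : GPISEResponder V d)
    (qs : List (GPISEQuery V d)) (e : Finset V) :
    e ∈ (collect qs).output O ↔ ∃ q ∈ qs, O q = some e := by
  induction qs with
  | nil => simp [collect, output]
  | cons q qs ih => simp [collect, output, output_bind, ih]

theorem numQueries_collect [DecidableEq V] (O : GPISEResponder V d)
    (qs : List (GPISEQuery V d)) : (collect qs).numQueries O = qs.length := by
  induction qs with
  | nil => rfl
  | cons q qs ih => simp [collect, numQueries, numQueries_bind, ih]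

end QueryAlg

section Samples

variable {V : Type*} [Fintype V] [DecidableEq V] {d b : ℕ}

theorem mem_output_colorSample (O : GPISEResponder V d) (h : V → Fin b) (e : Finset V) :
    e ∈ (colorSample d h).output O ↔ ∃ s : ColorTuple d h, O (colorQuery h s) = some e := by
  simp [colorSample, QueryAlg.mem_output_collect]

theorem mem_output_unionOfSamples (O : GPISEResponder V d) (hs : List (V → Fin b))
    (e : Finset V) :
    e ∈ (unionOfSamples d hs).output O ↔ ∃ h ∈ hs, e ∈ (colorSample d h).output O := by
  induction hs with
  | nil => simp [unionOfSamples, QueryAlg.output]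
  | cons h hs ih => simp [unionOfSamples, QueryAlg.output, QueryAlg.output_bind, ih]

theorem numQueries_colorSample_le (O : GPISEResponder V d) (h : V → Fin b) :
    (colorSample d h).numQueries O ≤ b ^ d := by
  have := Fintype.card_le_of_injective (fun s : ColorTuple d h => s.1)
    (fun s t hst => Subtype.ext hst)
  simpa [colorSample, QueryAlg.numQueries_collect] using this

theorem numQueries_unionOfSamples_le (O : GPISEResponder V d) (hs : List (V → Fin b)) :
    (unionOfSamples d hs).numQueries O ≤ hs.length * b ^ d := by
  induction hs with
  | nil => simp [unionOfSamples, QueryAlg.numQueries]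
  | cons h hs ih =>
    have := numQueries_colorSample_le O h
    simp only [unionOfSamples, QueryAlg.numQueries, QueryAlg.numQueries_bind, List.length_cons]
    linarith

/-- The edges crossing a query made of color classes are those on which the coloring is
injective and takes exactly the colors of the query. -/
theorem crosses_colorQuery_iff (h : V → Fin b) (s : ColorTuple d h) (e : Finset V) :
    (colorQuery h s).Crosses e ↔
      Set.InjOn h e ∧ e.image h = Finset.univ.image s.1 := by
  have hmem : ∀ i v, v ∈ (colorQuery h s).part i ↔ h v = s.1 i := by
    intro i v
    simp [colorQuery, colorClass]
  constructor
  · rintro ⟨u, hu, rfl⟩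
    simp only [hmem] at hu
    constructor
    · intro x hx y hy hxy
      simp only [Finset.coe_image, Finset.coe_univ, Set.image_univ, Set.mem_range] at hx hy
      obtain ⟨i, rfl⟩ := hx
      obtain ⟨j, rfl⟩ := hy
      rw [hu, hu] at hxy
      rw [s.2.1.injective hxy]
    · rw [Finset.image_image]
      exact Finset.image_congr fun i _ => hu i
  · rintro ⟨hinj, him⟩
    have hex : ∀ i, ∃ v ∈ e, h v = s.1 i := fun i =>
      Finset.mem_image.1 (him ▸ Finset.mem_image_of_mem s.1 (Finset.mem_univ i))
    choose u hue hu using hex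
    refine ⟨u, fun i => (hmem i _).2 (hu i), ?_⟩
    ext v
    simp only [Finset.mem_image, Finset.mem_univ, true_and]
    constructor
    · rintro ⟨i, rfl⟩
      exact hue i
    · intro hv
      obtain ⟨i, -, hi⟩ := Finset.mem_image.1 (him ▸ Finset.mem_image_of_mem h hv)
      exact ⟨i, hinj (hue i) hv ((hu i).trans hi)⟩

theorem colorSample_output_subset {𝓕 : Finset (Finset V)} {O : GPISEResponder V d}
    (hO : IsGPISEOracle 𝓕 O) (h : V → Fin b) : (colorSample d h).output O ⊆ 𝓕 := by
  intro e he
  obtain ⟨s, hs⟩ := (mem_output_colorSample O h e).1 he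
  exact (hO.of_some _ _ hs).1

/-- Every rainbow hyperedge `e` makes the sample contain a rainbow hyperedge with the same
colors. -/
theorem exists_mem_output_colorSample {𝓕 : Finset (Finset V)} {O : GPISEResponder V d}
    (hO : IsGPISEOracle 𝓕 O) (h : V → Fin b) {e : Finset V} (he : e ∈ 𝓕) (hcard : e.card = d)
    (hinj : Set.InjOn h e) :
    ∃ f ∈ (colorSample d h).output O, Set.InjOn h f ∧ f.image h = e.image h := by
  have hc : (e.image h).card = d := (Finset.card_image_of_injOn hinj).trans hcard
  have hrange : Finset.univ.image ((e.image h).orderEmbOfFin hc) = e.image h := by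
    rw [← Finset.coe_inj, Finset.coe_image, Finset.coe_univ, Set.image_univ,
      Finset.range_orderEmbOfFin]
  let s : ColorTuple d h := ⟨(e.image h).orderEmbOfFin hc, OrderEmbedding.strictMono _, by
    intro j
    obtain ⟨v, -, hv⟩ := Finset.mem_image.1 (Finset.orderEmbOfFin_mem (e.image h) hc j)
    exact ⟨v, Finset.mem_filter.2 ⟨Finset.mem_univ _, hv⟩⟩⟩
  have hes : (colorQuery h s).Crosses e := (crosses_colorQuery_iff h s e).2 ⟨hinj, hrange.symm⟩
  cases hq : O (colorQuery h s) with
  | none => exact absurd hes (hO.of_none _ hq e he)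
  | some f =>
    obtain ⟨h1, h2⟩ := (crosses_colorQuery_iff h s f).1 (hO.of_some _ _ hq).2
    exact ⟨f, (mem_output_colorSample O h f).2 ⟨s, hq⟩, h1, h2.trans hrange⟩

end Samples

/-! ### Sunflowers and minimal cores -/

section Sunflowers

variable {V : Type*} [DecidableEq V]

/-- `C` is the core of a sunflower of `N` hyperedges of `𝓕`: they contain `C`, and their petals,
which are what remains of them outside `C`, are pairwise disjoint. Petals may be empty and
hyperedges may be repeated, so every hyperedge is the core of sunflowers of all sizes. -/
def HasSunflower (𝓕 : Finset (Finset V)) (C : Finset V) (N : ℕ) : Prop :=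
  ∃ f : ℕ → Finset V, (∀ i < N, f i ∈ 𝓕 ∧ C ⊆ f i) ∧
    ∀ i < N, ∀ j < N, i ≠ j → Disjoint (f i \ C) (f j \ C)

theorem hasSunflower_of_mem {𝓕 : Finset (Finset V)} {e : Finset V} (he : e ∈ 𝓕) (N : ℕ) :
    HasSunflower 𝓕 e N :=
  ⟨fun _ => e, fun _ _ => ⟨he, subset_rfl⟩, by simp⟩

/-- If there is no sunflower with core `C` and `N` petals, then the vertices of a largest
sunflower with core `C` meet all the petals at `C`. -/
theorem hasSunflower_or_exists_cover {𝓕 : Finset (Finset V)} {d : ℕ}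
    (hd : ∀ e ∈ 𝓕, e.card = d) (C : Finset V) (N : ℕ) :
    HasSunflower 𝓕 C N ∨
      ∃ X : Finset V, X.card ≤ d * N ∧ ∀ e ∈ 𝓕, C ⊆ e → ¬ Disjoint (e \ C) X := by
  induction N with
  | zero => exact Or.inl ⟨fun _ => ∅, by simp, by simp⟩
  | succ N ih =>
    rcases ih with ⟨f, hf, hdisj⟩ | ⟨X, hX, hcov⟩
    swap
    · exact Or.inr ⟨X, hX.trans (Nat.mul_le_mul_left _ (Nat.le_succ N)), hcov⟩
    by_cases hex : ∃ e ∈ 𝓕, C ⊆ e ∧ Disjoint (e \ C) ((Finset.range N).biUnion fun i => f i \ C)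
    · left
      obtain ⟨e, he, hCe, hdis⟩ := hex
      have hdis' : ∀ i < N, Disjoint (e \ C) (f i \ C) := fun i hi =>
        (Finset.disjoint_biUnion_right _ _ _).1 hdis i (Finset.mem_range.2 hi)
      refine ⟨fun i => if i < N then f i else e, fun i _ => ?_, fun i _ j _ hij => ?_⟩
      · by_cases hiN : i < N
        · simpa [hiN] using hf i hiN
        · simpa [hiN] using ⟨he, hCe⟩
      · by_cases hiN : i < N <;> by_cases hjN : j < N
        · simpa [hiN, hjN] using hdisj i hiN j hjN hij
        · simpa [hiN, hjN] using (hdis' i hiN).symm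
        · simpa [hiN, hjN] using hdis' j hjN
        · omega
    · right
      push Not at hex
      refine ⟨(Finset.range N).biUnion fun i => f i \ C, ?_, fun e he hCe => hex e he hCe⟩
      calc _ ≤ ∑ i ∈ Finset.range N, (f i \ C).card := Finset.card_biUnion_le
        _ ≤ ∑ i ∈ Finset.range N, d := Finset.sum_le_sum fun i hi =>
          (Finset.card_le_card Finset.sdiff_subset).trans
            (hd _ (hf i (Finset.mem_range.1 hi)).1).le
        _ ≤ d * (N + 1) := by simp; nlinarith

/-- `C` is an inclusion-minimal set that is the core of a large sunflower, where the number of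
petals required of a core with `j` vertices is `N j`. -/
abbrev IsMinimalCore (𝓕 : Finset (Finset V)) (N : ℕ → ℕ) (C : Finset V) : Prop :=
  Minimal (fun D => HasSunflower 𝓕 D (N D.card)) C

theorem exists_isMinimalCore_subset {𝓕 : Finset (Finset V)} (N : ℕ → ℕ) {e : Finset V}
    (he : e ∈ 𝓕) : ∃ C ⊆ e, IsMinimalCore 𝓕 N C :=
  exists_minimal_le_of_wellFoundedLT (fun D => HasSunflower 𝓕 D (N D.card)) e
    (hasSunflower_of_mem he _)

theorem IsMinimalCore.card_le {𝓕 : Finset (Finset V)} {d : ℕ} (hd : ∀ e ∈ 𝓕, e.card = d)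
    {N : ℕ → ℕ} (hN : ∀ j, 0 < N j) {C : Finset V} (hC : IsMinimalCore 𝓕 N C) :
    C.card ≤ d := by
  obtain ⟨f, hf, -⟩ := hC.prop
  obtain ⟨h1, h2⟩ := hf 0 (hN _)
  exact (Finset.card_le_card h2).trans (hd _ h1).le

/-- A set meeting every hyperedge of a sunflower, with fewer elements than there are petals,
meets the core. -/
theorem HasSunflower.not_disjoint {𝓕 : Finset (Finset V)} {C X : Finset V} {N : ℕ}
    (hC : HasSunflower 𝓕 C N) (hX : X.card < N)
    (hcov : ∀ e ∈ 𝓕, C ⊆ e → ¬ Disjoint e X) : ¬ Disjoint C X := by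
  intro hdis
  obtain ⟨f, hf, hdisj⟩ := hC
  have hex : ∀ i, ∃ x, i < N → x ∈ f i \ C ∧ x ∈ X := by
    intro i
    by_cases hi : i < N
    · obtain ⟨x, hx, hxX⟩ := Finset.not_disjoint_iff.1 (hcov _ (hf i hi).1 (hf i hi).2)
      exact ⟨x, fun _ => ⟨Finset.mem_sdiff.2
        ⟨hx, fun hxC => Finset.disjoint_left.1 hdis hxC hxX⟩, hxX⟩⟩
    · obtain ⟨x, -⟩ : ∃ x : V, True := by
        obtain ⟨x, -, -⟩ := Finset.not_disjoint_iff.1 (hcov _ (hf 0 (by omega)).1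
          (hf 0 (by omega)).2)
        exact ⟨x, trivial⟩
      exact ⟨x, fun h => absurd h hi⟩
  choose x hx using hex
  have hle := Finset.card_le_card_of_injOn (s := Finset.range N) (t := X) x
    (fun i hi => (hx i (Finset.mem_range.1 hi)).2) (by
      intro i hi j hj hij
      by_contra hne
      have hi' := Finset.mem_range.1 hi
      have hj' := Finset.mem_range.1 hj
      exact Finset.disjoint_left.1 (hdisj i hi' j hj' hne) (hx i hi').1
        (hij ▸ (hx j hj').1))
  rw [Finset.card_range] at hle
  omega

/-- The minimal cores can be enumerated by branching: a set `D` properly contained in a minimal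
core `C` has a cover of size at most `M` that meets all the petals at `D`, and this cover has an
element in `C \ D`. -/
theorem exists_finset_isMinimalCore {𝓕 : Finset (Finset V)} {d M : ℕ}
    (hd : ∀ e ∈ 𝓕, e.card = d) {N : ℕ → ℕ} (hN : ∀ i j, i < j → d * N i < N j)
    (hpos : ∀ j, 0 < N j) (hM : ∀ j ≤ d, d * N j ≤ M) :
    ∃ G : Finset (Finset V), G.card ≤ (1 + M) ^ d ∧ ∀ C, IsMinimalCore 𝓕 N C → C ∈ G := by
  have hex : ∀ D : Finset V, ∃ X : Finset V, X.card ≤ M ∧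
      (D.card ≤ d → ¬ HasSunflower 𝓕 D (N D.card) →
        X.card ≤ d * N D.card ∧ ∀ e ∈ 𝓕, D ⊆ e → ¬ Disjoint (e \ D) X) := by
    intro D
    by_cases h : D.card ≤ d ∧ ¬ HasSunflower 𝓕 D (N D.card)
    · obtain ⟨X, h1, h2⟩ := (hasSunflower_or_exists_cover hd D (N D.card)).resolve_left h.2
      exact ⟨X, h1.trans (hM _ h.1), fun _ _ => ⟨h1, h2⟩⟩
    · exact ⟨∅, by simp, fun h1 h2 => absurd ⟨h1, h2⟩ h⟩
  choose X hXM hX using hex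
  -- `G n` holds the sets obtained from `∅` by at most `n` additions of an element of the current
  -- cover.
  let G : ℕ → Finset (Finset V) := fun n =>
    Nat.rec {∅} (fun _ H => H ∪ H.biUnion fun D => (X D).image fun x => insert x D) n
  have hG : ∀ n, G (n + 1) = G n ∪ (G n).biUnion fun D => (X D).image fun x => insert x D :=
    fun _ => rfl
  have hcard : ∀ n, (G n).card ≤ (1 + M) ^ n := by
    intro n
    induction n with
    | zero => simp [G]
    | succ n ih =>
      rw [hG]
      calc _ ≤ (G n).card + ((G n).biUnion fun D => (X D).image fun x => insert x D).card :=
            Finset.card_union_le _ _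
        _ ≤ (G n).card + (G n).card * M := by
            gcongr
            exact Finset.card_biUnion_le_card_mul _ _ _ fun D _ =>
              Finset.card_image_le.trans (hXM D)
        _ = (G n).card * (1 + M) := by ring
        _ ≤ (1 + M) ^ (n + 1) := by rw [pow_succ]; gcongr
  have hmono : Monotone G := monotone_nat_of_le_succ fun n => by
    rw [hG]; exact Finset.subset_union_left
  refine ⟨G d, hcard d, fun C hC => ?_⟩
  have hCd := IsMinimalCore.card_le hd hpos hC
  have key : ∀ n ≤ C.card, ∃ D ∈ G n, D ⊆ C ∧ D.card = n := by
    intro n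
    induction n with
    | zero => intro _; exact ⟨∅, by simp [G], by simp, rfl⟩
    | succ n ih =>
      intro hn
      obtain ⟨D, hDG, hDC, hDn⟩ := ih (by omega)
      have hns : ¬ HasSunflower 𝓕 D (N D.card) := by
        intro h
        have := Finset.card_le_card (hC.2 h hDC)
        omega
      obtain ⟨h1, h2⟩ := hX D (by omega) hns
      have hsub : ∀ e ∈ 𝓕, C ⊆ e → ¬ Disjoint e (X D \ D) := by
        intro e he hCe
        obtain ⟨x, hx, hxX⟩ := Finset.not_disjoint_iff.1 (h2 e he (hDC.trans hCe))
        rw [Finset.mem_sdiff] at hx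
        exact Finset.not_disjoint_iff.2 ⟨x, hx.1, Finset.mem_sdiff.2 ⟨hxX, hx.2⟩⟩
      have hlt : (X D \ D).card < N C.card :=
        ((Finset.card_le_card Finset.sdiff_subset).trans h1).trans_lt (hN _ _ (by omega))
      obtain ⟨x, hxC, hx⟩ := Finset.not_disjoint_iff.1 (hC.prop.not_disjoint hlt hsub)
      rw [Finset.mem_sdiff] at hx
      refine ⟨insert x D, ?_, Finset.insert_subset hxC hDC, ?_⟩
      · rw [hG]
        exact Finset.mem_union_right _ (Finset.mem_biUnion.2
          ⟨D, hDG, Finset.mem_image_of_mem _ hx.1⟩)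
      · rw [Finset.card_insert_of_notMem hx.2, hDn]
  obtain ⟨D, hDG, hDC, hDn⟩ := key C.card le_rfl
  rw [← Finset.eq_of_subset_of_card_le hDC hDn.ge]
  exact hmono hCd hDG

/-- The hyperedges not containing a minimal core `C` are met by a small set `X` outside `C`: the
union of the covers of the petals at all proper subsets of `C`. -/
theorem IsMinimalCore.exists_cover {𝓕 : Finset (Finset V)} {d : ℕ} (hd : ∀ e ∈ 𝓕, e.card = d)
    {N : ℕ → ℕ} {C : Finset V} (hC : IsMinimalCore 𝓕 N C) {m : ℕ}
    (hm : ∀ j < C.card, d * N j ≤ m) :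
    ∃ X : Finset V, X.card ≤ 2 ^ C.card * m ∧ Disjoint C X ∧
      ∀ e ∈ 𝓕, Disjoint e X → C ⊆ e := by
  have hex : ∀ D : Finset V, ∃ X : Finset V, D ⊂ C →
      X.card ≤ m ∧ ∀ e ∈ 𝓕, D ⊆ e → ¬ Disjoint (e \ D) X := by
    intro D
    by_cases h : D ⊂ C
    · obtain ⟨X, h1, h2⟩ := (hasSunflower_or_exists_cover hd D (N D.card)).resolve_left
        fun h' => h.not_subset (hC.2 h' h.subset)
      exact ⟨X, fun _ => ⟨h1.trans (hm _ (Finset.card_lt_card h)), h2⟩⟩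
    · exact ⟨∅, fun h' => absurd h' h⟩
  choose X hX using hex
  refine ⟨C.ssubsets.biUnion X \ C, ?_, Finset.disjoint_sdiff, fun e he hdis => ?_⟩
  · calc _ ≤ (C.ssubsets.biUnion X).card := Finset.card_le_card Finset.sdiff_subset
      _ ≤ C.ssubsets.card * m := Finset.card_biUnion_le_card_mul _ _ _ fun D hD =>
          (hX D (Finset.mem_ssubsets.1 hD)).1
      _ ≤ 2 ^ C.card * m := by
          gcongr
          rw [← Finset.card_powerset]
          exact Finset.card_le_card (Finset.erase_subset _ _)
  · by_contra hCe
    have hss : e ∩ C ⊂ C := by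
      refine Finset.inter_subset_right.ssubset_of_ne fun h => hCe ?_
      exact Finset.inter_eq_right.1 h
    obtain ⟨x, hx, hxX⟩ :=
      Finset.not_disjoint_iff.1 ((hX _ hss).2 e he Finset.inter_subset_left)
    simp only [Finset.mem_sdiff, Finset.mem_inter, not_and] at hx
    exact Finset.disjoint_left.1 hdis hx.1 (Finset.mem_sdiff.2
      ⟨Finset.mem_biUnion.2 ⟨_, Finset.mem_ssubsets.2 hss, hxX⟩, hx.2 hx.1⟩)

end Sunflowers

/-! ### Forcing a core by one sample -/

section Forcing

variable {V : Type*} [DecidableEq V]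

/-- The set system `𝓖` forces `C` if all its hitting sets with at most `k` elements meet `C`. -/
def Forces (𝓖 : Finset (Finset V)) (k : ℕ) (C : Finset V) : Prop :=
  ∀ S : Finset V, S.card ≤ k → IsHittingSet 𝓖 S → ¬ Disjoint C S

theorem IsHittingSet.mono {𝓖 𝓗 : Finset (Finset V)} (h : 𝓖 ⊆ 𝓗) {S : Finset V}
    (hS : IsHittingSet 𝓗 S) : IsHittingSet 𝓖 S :=
  fun e he => hS e (h he)

theorem Forces.mono {𝓖 𝓗 : Finset (Finset V)} (h : 𝓖 ⊆ 𝓗) {k : ℕ} {C : Finset V}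
    (hC : Forces 𝓖 k C) : Forces 𝓗 k C :=
  fun S hS hS' => hC S hS (hS'.mono h)

/-- The color of `v` under `h` is not used by any other vertex of `W`. -/
def IsIsolated {b : ℕ} (h : V → Fin b) (W : Finset V) (v : V) : Prop :=
  ∀ w ∈ W, w ≠ v → h w ≠ h v

/-- If the coloring isolates the core and more than `k + |X|` petals of a sunflower, where `X`
is a set outside the core meeting all the hyperedges that do not contain the core, then the sample
forces the core. For an isolated petal whose colors avoid `X`, the oracle has to answer with a
hyperedge containing the core. So the colors of `X` together with those of a hitting set
disjoint from the core would meet the color sets of all the isolated petals, which are pairwise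
disjoint. -/
theorem forces_colorSample [Fintype V] {d b k N : ℕ} {𝓕 : Finset (Finset V)}
    {O : GPISEResponder V d} (hO : IsGPISEOracle 𝓕 O) (hd : ∀ e ∈ 𝓕, e.card = d)
    {C X W : Finset V} (hCX : Disjoint C X) (hcov : ∀ e ∈ 𝓕, Disjoint e X → C ⊆ e)
    {f : ℕ → Finset V} (hf : ∀ i < N, f i ∈ 𝓕 ∧ C ⊆ f i)
    (hdisj : ∀ i < N, ∀ j < N, i ≠ j → Disjoint (f i \ C) (f j \ C))
    (hCW : C ⊆ W) (hXW : X ⊆ W) (hfW : ∀ i < N, f i \ C ⊆ W) (h : V → Fin b)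
    (hC : ∀ v ∈ C, IsIsolated h W v) {good : Finset ℕ}
    (hgood : ∀ i ∈ good, i < N ∧ ∀ v ∈ f i \ C, IsIsolated h W v)
    (hcard : k + X.card < good.card) :
    Forces ((colorSample d h).output O) k C := by
  intro S hSk hS hCS
  have hcol : ∀ i ∈ good, ∃ v ∈ f i \ C, h v ∈ S.image h ∪ X.image h := by
    intro i hi
    by_contra hno
    push Not at hno
    obtain ⟨hiN, hiso⟩ := hgood i hi
    obtain ⟨hiF, hCi⟩ := hf i hiN
    have hiso' : ∀ v ∈ f i, v ∈ W ∧ IsIsolated h W v := by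
      intro v hv
      by_cases hvC : v ∈ C
      · exact ⟨hCW hvC, hC v hvC⟩
      · have := Finset.mem_sdiff.2 ⟨hv, hvC⟩
        exact ⟨hfW i hiN this, hiso v this⟩
    have hinj : Set.InjOn h (f i) := by
      intro v hv w hw hvw
      by_contra hne
      exact (hiso' w hw).2 v (hiso' v hv).1 hne hvw
    obtain ⟨g, hg, hginj, hgim⟩ := exists_mem_output_colorSample hO h hiF (hd _ hiF) hinj
    have hgF := colorSample_output_subset hO h hg
    -- A vertex of `g` sharing no color with the petal has the color of a vertex of the core.
    have hcore : ∀ x ∈ g, (∀ v ∈ f i \ C, h v ≠ h x) → ∃ c ∈ C, h c = h x := by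
      intro x hx hxn
      obtain ⟨v, hv, hvx⟩ := Finset.mem_image.1 (hgim ▸ Finset.mem_image_of_mem h hx)
      by_cases hvC : v ∈ C
      · exact ⟨v, hvC, hvx⟩
      · exact absurd hvx (hxn v (Finset.mem_sdiff.2 ⟨hv, hvC⟩))
    have hgX : Disjoint g X := by
      rw [Finset.disjoint_left]
      intro x hxg hxX
      obtain ⟨c, hc, hcx⟩ := hcore x hxg fun v hv hvx => hno v hv
        (Finset.mem_union_right _ (hvx ▸ Finset.mem_image_of_mem h hxX))
      refine hC c hc x (hXW hxX) ?_ hcx.symm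
      rintro rfl
      exact Finset.disjoint_left.1 hCX hc hxX
    have hCg : C ⊆ g := hcov g hgF hgX
    obtain ⟨s, hs⟩ := hS g hg
    obtain ⟨hsg, hsS⟩ := Finset.mem_inter.1 hs
    obtain ⟨c, hc, hcs⟩ := hcore s hsg fun v hv hvs => hno v hv
      (Finset.mem_union_left _ (hvs ▸ Finset.mem_image_of_mem h hsS))
    have := hginj (hCg hc) hsg hcs
    subst this
    exact Finset.disjoint_left.1 hCS hc hsS
  have hex : ∀ i, ∃ y : Fin b, i ∈ good →
      y ∈ S.image h ∪ X.image h ∧ ∃ v ∈ f i \ C, h v = y := by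
    intro i
    by_cases hi : i ∈ good
    · obtain ⟨v, hv, hvh⟩ := hcol i hi
      exact ⟨h v, fun _ => ⟨hvh, v, hv, rfl⟩⟩
    · obtain ⟨j, hj⟩ : good.Nonempty := Finset.card_pos.1 (by omega)
      obtain ⟨v, -⟩ := hcol j hj
      exact ⟨h v, fun h' => absurd h' hi⟩
  choose y hy using hex
  have hle := Finset.card_le_card_of_injOn (s := good) (t := S.image h ∪ X.image h) y
    (fun i hi => (hy i hi).1) (by
      intro i hi j hj hij
      by_contra hne
      obtain ⟨v, hv, hvy⟩ := (hy i hi).2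
      obtain ⟨w, hw, hwy⟩ := (hy j hj).2
      obtain ⟨hjN, hjiso⟩ := hgood j hj
      obtain ⟨hiN, -⟩ := hgood i hi
      refine hjiso w hw v (hfW i hiN hv) ?_ (by rw [hvy, hwy, hij])
      rintro rfl
      exact Finset.disjoint_left.1 (hdisj i hiN j hjN hne) hv hw)
  have h1 := Finset.card_union_le (S.image h) (X.image h)
  have h2 := Finset.card_image_le (s := S) (f := h)
  have h3 := Finset.card_image_le (s := X) (f := h)
  omega

end Forcing

/-! ### Counting colorings -/

section Counting

variable {V : Type*} [Fintype V] [DecidableEq V] {b : ℕ}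

/-- Two distinct vertices share a color in at most a `1 / b` fraction of the colorings: recoloring
one of them in all `b` ways yields distinct colorings. -/
theorem card_filter_eq_color_mul_le {v w : V} (hvw : w ≠ v) :
    (Finset.univ.filter fun h : V → Fin b => h w = h v).card * b ≤
      Fintype.card (V → Fin b) := by
  have := Finset.card_le_card_of_injOn
    (s := (Finset.univ.filter fun h : V → Fin b => h w = h v) ×ˢ (Finset.univ : Finset (Fin b)))
    (t := Finset.univ) (fun p => Function.update p.1 w p.2) (fun _ _ => Finset.mem_univ _) (by
      rintro ⟨h, c⟩ hh ⟨h', c'⟩ hh' heq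
      simp only [Finset.coe_product, Finset.coe_filter, Finset.mem_univ, true_and,
        Finset.coe_univ, Set.mem_prod, Set.mem_ofPred_eq, Set.mem_univ, and_true] at hh hh'
      have hne : ∀ u, u ≠ w → h u = h' u := by
        intro u hu
        simpa [hu] using congrFun heq u
      have hcc : c = c' := by simpa using congrFun heq w
      refine Prod.ext (funext fun u => ?_) hcc
      by_cases hu : u = w
      · subst hu
        exact hh.trans ((hne v hvw.symm).trans hh'.symm)
      · exact hne u hu)
  rwa [Finset.card_product, Finset.card_univ (α := Fin b), Fintype.card_fin,
    Finset.card_univ] at this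

open Classical in
theorem card_filter_exists_not_isIsolated_mul_le (W A : Finset V) :
    (Finset.univ.filter fun h : V → Fin b => ∃ v ∈ A, ¬ IsIsolated h W v).card * b ≤
      A.card * W.card * Fintype.card (V → Fin b) := by
  have hsub : (Finset.univ.filter fun h : V → Fin b => ∃ v ∈ A, ¬ IsIsolated h W v) ⊆
      ((A ×ˢ W).filter fun p => p.2 ≠ p.1).biUnion fun p =>
        Finset.univ.filter fun h : V → Fin b => h p.2 = h p.1 := by
    intro h hh
    obtain ⟨v, hv, hiso⟩ := (Finset.mem_filter.1 hh).2
    unfold IsIsolated at hiso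
    push Not at hiso
    obtain ⟨w, hw, hwv, heq⟩ := hiso
    simp only [Finset.mem_biUnion, Finset.mem_filter, Finset.mem_product, Finset.mem_univ,
      true_and, Prod.exists]
    exact ⟨v, w, ⟨⟨hv, hw⟩, hwv⟩, heq⟩
  calc _ ≤ (∑ p ∈ (A ×ˢ W).filter fun p => p.2 ≠ p.1,
        (Finset.univ.filter fun h : V → Fin b => h p.2 = h p.1).card) * b :=
        Nat.mul_le_mul_right _ ((Finset.card_le_card hsub).trans Finset.card_biUnion_le)
    _ ≤ ∑ p ∈ (A ×ˢ W).filter fun p => p.2 ≠ p.1, Fintype.card (V → Fin b) := by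
        rw [Finset.sum_mul]
        exact Finset.sum_le_sum fun p hp =>
          card_filter_eq_color_mul_le (Finset.mem_filter.1 hp).2
    _ ≤ A.card * W.card * Fintype.card (V → Fin b) := by
        rw [Finset.sum_const, smul_eq_mul, ← Finset.card_product]
        exact Nat.mul_le_mul_right _ (Finset.card_filter_le _ _)

open Classical in
/-- Markov's inequality for the number of petals that a random coloring does not isolate. -/
theorem card_filter_many_not_isIsolated_mul_le {d N : ℕ} (hN : 0 < N) (W : Finset V)
    (P : ℕ → Finset V) (hP : ∀ i < N, (P i).card ≤ d) :
    (Finset.univ.filter fun h : V → Fin b =>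
      N ≤ 2 * ((Finset.range N).filter fun i => ∃ v ∈ P i, ¬ IsIsolated h W v).card).card * b ≤
      2 * d * W.card * Fintype.card (V → Fin b) := by
  set B := Finset.univ.filter fun h : V → Fin b =>
      N ≤ 2 * ((Finset.range N).filter fun i => ∃ v ∈ P i, ¬ IsIsolated h W v).card with hB
  have h1 : B.card * N ≤ 2 * ∑ i ∈ Finset.range N,
      (Finset.univ.filter fun h : V → Fin b => ∃ v ∈ P i, ¬ IsIsolated h W v).card := by
    calc B.card * N = ∑ h ∈ B, N := by simp
      _ ≤ ∑ h ∈ B,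
          2 * ((Finset.range N).filter fun i => ∃ v ∈ P i, ¬ IsIsolated h W v).card :=
          Finset.sum_le_sum fun h hh => (Finset.mem_filter.1 hh).2
      _ ≤ ∑ h : V → Fin b,
          2 * ((Finset.range N).filter fun i => ∃ v ∈ P i, ¬ IsIsolated h W v).card :=
          Finset.sum_le_sum_of_subset (Finset.subset_univ _)
      _ = _ := by
          rw [← Finset.mul_sum]
          congr 1
          simp only [Finset.card_filter]
          exact Finset.sum_comm
  have h2 : (∑ i ∈ Finset.range N,
      (Finset.univ.filter fun h : V → Fin b => ∃ v ∈ P i, ¬ IsIsolated h W v).card) * b ≤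
      N * (d * W.card * Fintype.card (V → Fin b)) := by
    rw [Finset.sum_mul]
    refine (Finset.sum_le_card_nsmul _ _ (d * W.card * Fintype.card (V → Fin b))
      fun i hi => ?_).trans (by simp)
    refine (card_filter_exists_not_isIsolated_mul_le W (P i)).trans ?_
    gcongr
    exact hP i (Finset.mem_range.1 hi)
  refine Nat.le_of_mul_le_mul_left ?_ hN
  calc N * (B.card * b) = B.card * N * b := by ring
    _ ≤ _ := Nat.mul_le_mul_right b h1
    _ = 2 * ((∑ i ∈ Finset.range N,
      (Finset.univ.filter fun h : V → Fin b => ∃ v ∈ P i, ¬ IsIsolated h W v).card) * b) := by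
        ring
    _ ≤ 2 * (N * (d * W.card * Fintype.card (V → Fin b))) := Nat.mul_le_mul_left 2 h2
    _ = _ := by ring

open Classical in
/-- At most half of the colorings fail to force a given minimal core. -/
theorem IsMinimalCore.card_filter_not_forces_le {d k m M : ℕ} {𝓕 : Finset (Finset V)}
    {O : GPISEResponder V d} (hO : IsGPISEOracle 𝓕 O) (hd : ∀ e ∈ 𝓕, e.card = d)
    {N : ℕ → ℕ} {C : Finset V} (hC : IsMinimalCore 𝓕 N C) (hpos : ∀ j, 0 < N j)
    (hm : ∀ j < C.card, d * N j ≤ m)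
    (hN : 2 * (k + 2 ^ C.card * m) ≤ N C.card)
    (hM : d + 2 ^ C.card * m + N C.card * d ≤ M) (hb : 6 * d * M ≤ b) (hb0 : 0 < b) :
    2 * (Finset.univ.filter fun h : V → Fin b =>
      ¬ Forces ((colorSample d h).output O) k C).card ≤ Fintype.card (V → Fin b) := by
  obtain ⟨X, hX, hCX, hcov⟩ := hC.exists_cover hd hm
  have hCd := hC.card_le hd hpos
  obtain ⟨f, hf, hdisj⟩ := hC.prop
  set n := N C.card with hn
  have hP : ∀ i < n, (f i \ C).card ≤ d := fun i hi =>
    (Finset.card_le_card Finset.sdiff_subset).trans (hd _ (hf i hi).1).le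
  set W := C ∪ X ∪ (Finset.range n).biUnion fun i => f i \ C with hW
  have hWM : W.card ≤ M := by
    have h1 : ((Finset.range n).biUnion fun i => f i \ C).card ≤ n * d := by
      simpa using Finset.card_biUnion_le_card_mul (Finset.range n) (fun i => f i \ C) d
        fun i hi => hP i (Finset.mem_range.1 hi)
    have h2 := Finset.card_union_le (C ∪ X) ((Finset.range n).biUnion fun i => f i \ C)
    have h3 := Finset.card_union_le C X
    rw [← hW] at h2
    omega
  set B₁ := Finset.univ.filter fun h : V → Fin b => ∃ v ∈ C, ¬ IsIsolated h W v with hB₁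
  set B₂ := Finset.univ.filter fun h : V → Fin b =>
    n ≤ 2 * ((Finset.range n).filter fun i => ∃ v ∈ f i \ C, ¬ IsIsolated h W v).card with hB₂
  have hsub : (Finset.univ.filter fun h : V → Fin b =>
      ¬ Forces ((colorSample d h).output O) k C) ⊆ B₁ ∪ B₂ := by
    intro h hh
    by_contra hnot
    simp only [hB₁, hB₂, Finset.mem_union, Finset.mem_filter, Finset.mem_univ, true_and,
      not_or] at hnot
    obtain ⟨h1, h2⟩ := hnot
    push Not at h1
    refine (Finset.mem_filter.1 hh).2 (forces_colorSample (W := W) hO hd hCX hcov hf hdisj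
      ?_ ?_ ?_ h h1 (good := (Finset.range n).filter
        fun i => ¬ ∃ v ∈ f i \ C, ¬ IsIsolated h W v) ?_ ?_)
    · exact Finset.subset_union_left.trans Finset.subset_union_left
    · exact Finset.subset_union_right.trans Finset.subset_union_left
    · intro i hi
      exact (Finset.subset_biUnion_of_mem (fun i => f i \ C) (Finset.mem_range.2 hi)).trans
        Finset.subset_union_right
    · intro i hi
      rw [Finset.mem_filter, Finset.mem_range] at hi
      push Not at hi
      exact hi
    · have := Finset.card_filter_add_card_filter_not (s := Finset.range n)
        (fun i => ∃ v ∈ f i \ C, ¬ IsIsolated h W v)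
      rw [Finset.card_range] at this
      omega
  have hc1 := card_filter_exists_not_isIsolated_mul_le (b := b) W C
  have hc2 := card_filter_many_not_isIsolated_mul_le (b := b) (hpos _) W (fun i => f i \ C) hP
  have hle := (Finset.card_le_card hsub).trans (Finset.card_union_le _ _)
  refine Nat.le_of_mul_le_mul_right ?_ hb0
  set T := Fintype.card (V → Fin b)
  calc _ ≤ 2 * (B₁.card + B₂.card) * b := by gcongr
    _ = 2 * (B₁.card * b + B₂.card * b) := by ring
    _ ≤ 2 * (C.card * W.card * T + 2 * d * W.card * T) := by gcongr
    _ ≤ 2 * (d * M * T + 2 * d * M * T) := by gcongr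
    _ = T * (6 * d * M) := by ring
    _ ≤ T * b := by gcongr

open Classical in
/-- The union bound over the cores, for `t` independent colorings. -/
theorem card_filter_exists_not_forces_mul_le {d k t : ℕ} (O : GPISEResponder V d)
    (G : Finset (Finset V))
    (hG : ∀ C ∈ G, 2 * (Finset.univ.filter fun h : V → Fin b =>
      ¬ Forces ((colorSample d h).output O) k C).card ≤ Fintype.card (V → Fin b)) :
    (Finset.univ.filter fun h : Fin t → V → Fin b =>
      ∃ C ∈ G, ¬ Forces ((unionOfSamples d (List.ofFn h)).output O) k C).card * 2 ^ t ≤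
      G.card * Fintype.card (Fin t → V → Fin b) := by
  have hsub : (Finset.univ.filter fun h : Fin t → V → Fin b =>
      ∃ C ∈ G, ¬ Forces ((unionOfSamples d (List.ofFn h)).output O) k C) ⊆
      G.biUnion fun C => Fintype.piFinset fun _ : Fin t =>
        Finset.univ.filter fun h : V → Fin b =>
          ¬ Forces ((colorSample d h).output O) k C := by
    intro h hh
    obtain ⟨C, hC, hF⟩ := (Finset.mem_filter.1 hh).2
    refine Finset.mem_biUnion.2 ⟨C, hC, Fintype.mem_piFinset.2 fun r =>
      Finset.mem_filter.2 ⟨Finset.mem_univ _, fun hr => hF (hr.mono fun e he => ?_)⟩⟩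
    exact (mem_output_unionOfSamples O _ e).2 ⟨h r, by simp, he⟩
  calc _ ≤ (∑ C ∈ G, (Finset.univ.filter fun h : V → Fin b =>
          ¬ Forces ((colorSample d h).output O) k C).card ^ t) * 2 ^ t := by
        refine Nat.mul_le_mul_right _ ((Finset.card_le_card hsub).trans
          (Finset.card_biUnion_le.trans_eq (Finset.sum_congr rfl fun C _ => ?_)))
        simp
    _ ≤ ∑ C ∈ G, Fintype.card (V → Fin b) ^ t := by
        rw [Finset.sum_mul]
        refine Finset.sum_le_sum fun C hC => ?_
        rw [← mul_pow, mul_comm]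
        exact Nat.pow_le_pow_left (hG C hC) t
    _ = _ := by
        rw [Finset.sum_const, smul_eq_mul, Fintype.card_fun (α := Fin t), Fintype.card_fin]

end Counting

/-! ### Correctness of the algorithm -/

section Correctness

variable {V : Type*} [DecidableEq V]

/-- If a subsystem `𝓖` of `𝓕` forces every minimal core of `𝓕`, then the minimum hitting sets of
`𝓖` are minimum hitting sets of `𝓕`: they have at most `k` elements, so they meet every minimal
core, and every hyperedge of `𝓕` contains one. -/
theorem IsMinHittingSet.of_forces {𝓕 𝓖 : Finset (Finset V)} {k : ℕ} (N : ℕ → ℕ) (hsub : 𝓖 ⊆ 𝓕)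
    (hk : ∃ S : Finset V, IsHittingSet 𝓕 S ∧ S.card ≤ k)
    (hforce : ∀ C, IsMinimalCore 𝓕 N C → Forces 𝓖 k C) {S : Finset V}
    (hS : IsMinHittingSet 𝓖 S) : IsMinHittingSet 𝓕 S := by
  refine ⟨fun e he => ?_, fun T hT => hS.2 T (hT.mono hsub)⟩
  obtain ⟨T, hT, hTk⟩ := hk
  obtain ⟨C, hCe, hC⟩ := exists_isMinimalCore_subset N he
  obtain ⟨x, hxC, hxS⟩ := Finset.not_disjoint_iff.1
    (hforce C hC S ((hS.2 T (hT.mono hsub)).trans hTk) hS.1)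
  exact ⟨x, Finset.mem_inter.2 ⟨hCe hxC, hxS⟩⟩

variable [Fintype V]

theorem unionOfSamples_output_subset {d b : ℕ} {𝓕 : Finset (Finset V)} {O : GPISEResponder V d}
    (hO : IsGPISEOracle 𝓕 O) (hs : List (V → Fin b)) : (unionOfSamples d hs).output O ⊆ 𝓕 := by
  intro e he
  obtain ⟨h, -, hh⟩ := (mem_output_unionOfSamples O hs e).1 he
  exact colorSample_output_subset hO h hh

open Classical in
/-- A bound on the number of tuples of colorings whose output violates `P` is a bound on the
probability of violating `P`. -/
theorem one_sub_le_prob_colorCodingAlg {d t : ℕ} {b : ℕ+}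
    (solve : Finset (Finset V) → Finset V) (O : GPISEResponder V d) (P : Finset V → Prop) {ε : ℝ}
    (hε : ((Finset.univ.filter fun h : Fin t → V → Fin b =>
        ¬ P (solve ((unionOfSamples d (List.ofFn h)).output O))).card : ℝ) ≤
      ε * Fintype.card (Fin t → V → Fin b)) :
    1 - ε ≤ (colorCodingAlg d t b solve).prob O P := by
  have hT : (0 : ℝ) < Fintype.card (Fin t → V → Fin b) := by exact_mod_cast Fintype.card_pos
  have hsum := Finset.card_filter_add_card_filter_not
    (s := (Finset.univ : Finset (Fin t → V → Fin b)))
    (fun h => P (solve ((unionOfSamples d (List.ofFn h)).output O)))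
  have hsum' := congrArg (Nat.cast : ℕ → ℝ) hsum
  push_cast [Finset.card_univ] at hsum'
  have hprob : (colorCodingAlg d t b solve).prob O P =
      ((Finset.univ.filter fun h : Fin t → V → Fin b =>
        P (solve ((unionOfSamples d (List.ofFn h)).output O))).card : ℝ) /
      Fintype.card (Fin t → V → Fin b) := by
    unfold RandQueryAlg.prob colorCodingAlg
    rw [PMF.toOuterMeasure_map_apply, PMF.toOuterMeasure_map_apply,
      PMF.toOuterMeasure_uniformOfFintype_apply, ENNReal.toReal_div, ENNReal.toReal_natCast,
      ENNReal.toReal_natCast, Fintype.card_subtype]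
    simp only [Set.mem_preimage, Set.mem_ofPred_eq, QueryAlg.output_bind, QueryAlg.output]
  rw [hprob, le_div_iff₀ hT]
  linarith

open Classical in
/-- At most a fraction `(Q k) ^ d / 2 ^ t` of the tuples of `t` colorings make the algorithm fail,
where `Q = 1 + d B ^ (d + 1)` and the number of colors is a suitable multiple of `k`. -/
theorem card_filter_not_isMinHittingSet_mul_le {d : ℕ} (hd : 1 ≤ d) (t k b : ℕ) (hk : 0 < k)
    {B M : ℕ} (hB : B = 2 * (1 + d * 2 ^ d))
    (hM : M = (d + 2 ^ d * d * B ^ (d + 1) + B ^ (d + 1) * d) * k) (hb : b = 6 * d * M)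
    {solve : Finset (Finset V) → Finset V} (hsolve : IsHittingSetSolver solve)
    {𝓕 : Finset (Finset V)} (hF : ∀ e ∈ 𝓕, e.card = d)
    (hprom : ∃ S : Finset V, IsHittingSet 𝓕 S ∧ S.card ≤ k)
    {O : GPISEResponder V d} (hO : IsGPISEOracle 𝓕 O) :
    (Finset.univ.filter fun h : Fin t → V → Fin b =>
        ¬ IsMinHittingSet 𝓕 (solve ((unionOfSamples d (List.ofFn h)).output O))).card * 2 ^ t ≤
      ((1 + d * B ^ (d + 1)) * k) ^ d * Fintype.card (Fin t → V → Fin b) := by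
  have hB1 : 1 ≤ B := by omega
  have hdB : d < B := by
    have := Nat.one_le_two_pow (n := d)
    nlinarith
  -- The number of petals grows with the core so fast that the covers at the smaller cores are
  -- negligible against the petals at the larger ones.
  set N : ℕ → ℕ := fun j => B ^ (j + 1) * k with hNdef
  have hpos : ∀ j, 0 < N j := fun j => by positivity
  have hlt : ∀ i j, i < j → d * N i < N j := by
    intro i j hij
    calc d * (B ^ (i + 1) * k) < B * (B ^ (i + 1) * k) :=
          Nat.mul_lt_mul_of_pos_right hdB (hpos i)
      _ = B ^ (i + 2) * k := by ring
      _ ≤ B ^ (j + 1) * k :=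
          Nat.mul_le_mul_right k (Nat.pow_le_pow_right hB1 (by omega))
  obtain ⟨G, hGcard, hG⟩ := exists_finset_isMinimalCore (M := d * (B ^ (d + 1) * k)) hF hlt hpos
    (fun j hj => by simp only [hNdef]; gcongr)
  have hhalf : ∀ C ∈ G.filter (IsMinimalCore 𝓕 N), 2 * (Finset.univ.filter fun h : V → Fin b =>
      ¬ Forces ((colorSample d h).output O) k C).card ≤ Fintype.card (V → Fin b) := by
    intro C hCG
    have hC := (Finset.mem_filter.1 hCG).2
    have hCd := hC.card_le hF hpos
    refine hC.card_filter_not_forces_le (m := d * (B ^ C.card * k)) (M := M) hO hF hpos ?_ ?_ ?_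
      hb.ge ?_
    · intro j hj
      simp only [hNdef]
      gcongr
      exact hj
    · calc 2 * (k + 2 ^ C.card * (d * (B ^ C.card * k)))
          ≤ 2 * (B ^ C.card * k + 2 ^ d * (d * (B ^ C.card * k))) := by
            gcongr
            · exact Nat.le_mul_of_pos_left k (by positivity)
            · norm_num
        _ = B ^ C.card * (2 * (1 + d * 2 ^ d)) * k := by ring
        _ = B ^ (C.card + 1) * k := by rw [← hB, pow_succ]
    · calc d + 2 ^ C.card * (d * (B ^ C.card * k)) + B ^ (C.card + 1) * k * d
          ≤ d * k + 2 ^ d * (d * (B ^ (d + 1) * k)) + B ^ (d + 1) * k * d := by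
            gcongr
            · exact Nat.le_mul_of_pos_right d hk
            · norm_num
            · omega
        _ = M := by rw [hM]; ring
    · rw [hb, hM]; positivity
  have hunion := card_filter_exists_not_forces_mul_le (t := t) O _ hhalf
  have hfail : (Finset.univ.filter fun h : Fin t → V → Fin b =>
        ¬ IsMinHittingSet 𝓕 (solve ((unionOfSamples d (List.ofFn h)).output O))) ⊆
      Finset.univ.filter fun h : Fin t → V → Fin b => ∃ C ∈ G.filter (IsMinimalCore 𝓕 N),
        ¬ Forces ((unionOfSamples d (List.ofFn h)).output O) k C := by
    intro h hh
    refine Finset.mem_filter.2 ⟨Finset.mem_univ _, ?_⟩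
    by_contra hno
    push Not at hno
    have hsub := unionOfSamples_output_subset hO (List.ofFn h)
    refine (Finset.mem_filter.1 hh).2 (IsMinHittingSet.of_forces N hsub hprom
      (fun C hC => hno C (Finset.mem_filter.2 ⟨hG C hC, hC⟩)) (hsolve _ fun h0 => ?_))
    have := hF _ (hsub h0)
    rw [Finset.card_empty] at this
    omega
  calc _ ≤ _ := Nat.mul_le_mul_right _ (Finset.card_le_card hfail)
    _ ≤ _ := hunion
    _ ≤ _ := by
      refine Nat.mul_le_mul_right _ ((Finset.card_filter_le _ _).trans (hGcard.trans ?_))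
      refine Nat.pow_le_pow_left ?_ d
      nlinarith

end Correctness

theorem mainTheorem2 (d : ℕ) (hd : 1 ≤ d) (c : ℝ) (hc : 0 < c) :
    ∃ (α : ℕ) (β : ℕ+) (C : ℝ),
      ∀ (k : ℕ+) (V : Type*) [Fintype V] [DecidableEq V]
        (solve : Finset (Finset V) → Finset V), IsHittingSetSolver solve →
        -- the number of queries, for every random choice and whatever the answers are
        (∀ A ∈ (colorCodingAlg d ⌈(α : ℝ) * Real.log k⌉₊ (β * k) solve).support,
          ∀ O : GPISEResponder V d,
            (A.numQueries O : ℝ) ≤ C * ((k : ℝ) ^ d * Real.log k)) ∧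
        -- correctness with high probability, under the promise
        (∀ 𝓕 : Finset (Finset V), (∀ e ∈ 𝓕, e.card = d) →
          (∃ S : Finset V, IsHittingSet 𝓕 S ∧ S.card ≤ (k : ℕ)) →
          ∀ O : GPISEResponder V d, IsGPISEOracle 𝓕 O →
            1 - 1 / (k : ℝ) ^ c ≤
              (colorCodingAlg d ⌈(α : ℝ) * Real.log k⌉₊ (β * k) solve).prob O
                (fun S => IsMinHittingSet 𝓕 S)) := by
  classical
  obtain ⟨B, hB⟩ : ∃ B, B = 2 * (1 + d * 2 ^ d) := ⟨_, rfl⟩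
  obtain ⟨Q, hQ⟩ : ∃ Q, Q = 1 + d * B ^ (d + 1) := ⟨_, rfl⟩
  -- `α` makes `2 ^ (α log k) = k ^ (α log 2)` at least `k ^ c` times the number of cores, which
  -- is at most `(Q k) ^ d ≤ k ^ ((Q + 1) d)` for `k ≥ 2`.
  obtain ⟨α, hα⟩ := exists_nat_ge ((c + ((Q + 1) * d : ℕ)) / Real.log 2)
  have hlog2 : 0 < Real.log 2 := Real.log_pos one_lt_two
  rw [div_le_iff₀ hlog2] at hα
  -- With `b = β k` colors, all but a `1 / (6 d)` fraction of the colorings isolate a given vertex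
  -- among a core, the cover outside it and the petals of its sunflower.
  obtain ⟨β, hβ⟩ : ∃ β : ℕ+,
      (β : ℕ) = 6 * d * (d + 2 ^ d * d * B ^ (d + 1) + B ^ (d + 1) * d) :=
    ⟨⟨_, by positivity⟩, rfl⟩
  refine ⟨α, β, (α + 2) * (β : ℝ) ^ d, fun k V _ _ solve hsolve => ⟨?_, ?_⟩⟩
  · intro A hA O
    obtain ⟨h, -, rfl⟩ := (PMF.mem_support_map_iff _ _ _).1 hA
    have hle := numQueries_unionOfSamples_le O (List.ofFn h)
    rw [List.length_ofFn] at hle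
    -- The rounding up is absorbed by `1 ≤ 2 log k` for `k ≥ 2`; for `k = 1` there are no samples.
    have hceil : ((⌈(α : ℝ) * Real.log k⌉₊ : ℕ) : ℝ) ≤ (α + 2) * Real.log k := by
      rcases Nat.lt_or_ge (k : ℕ) 2 with hk | hk
      · have : (k : ℕ) = 1 := by have := k.pos; omega
        simp [this]
      · have h1 : Real.log 2 ≤ Real.log k := Real.log_le_log two_pos (by exact_mod_cast hk)
        have h2 := (Nat.ceil_lt_add_one (a := (α : ℝ) * Real.log k)
          (mul_nonneg α.cast_nonneg (hlog2.le.trans h1))).le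
        have := Real.log_two_gt_d9
        linarith
    rw [QueryAlg.numQueries_bind, QueryAlg.numQueries, add_zero]
    calc _ ≤ ((⌈(α : ℝ) * Real.log k⌉₊ * ((β * k : ℕ+) : ℕ) ^ d : ℕ) : ℝ) := by
          exact_mod_cast hle
      _ = (⌈(α : ℝ) * Real.log k⌉₊ : ℝ) * ((β : ℝ) ^ d * (k : ℝ) ^ d) := by
          push_cast; ring
      _ ≤ ((α + 2) * Real.log k) * ((β : ℝ) ^ d * (k : ℝ) ^ d) := by gcongr
      _ = _ := by ring
  · intro 𝓕 hF hprom O hO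
    apply one_sub_le_prob_colorCodingAlg
    have hk0 : (0 : ℝ) < k := by exact_mod_cast k.pos
    set T := Fintype.card (Fin ⌈(α : ℝ) * Real.log k⌉₊ → V → Fin ((β * k : ℕ+) : ℕ)) with hT
    -- For `k = 1` the claimed lower bound on the probability is `0`.
    rcases Nat.lt_or_ge (k : ℕ) 2 with hk | hk
    · have hk1 : (k : ℕ) = 1 := by have := k.pos; omega
      have hkc : 1 / (k : ℝ) ^ c = 1 := by simp [hk1]
      rw [hkc, one_mul]
      exact Nat.cast_le.2 (Finset.card_le_univ _)
    have hcount := card_filter_not_isMinHittingSet_mul_le hd ⌈(α : ℝ) * Real.log k⌉₊ k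
      ((β * k : ℕ+) : ℕ) k.pos hB rfl (by rw [PNat.mul_coe, hβ]; ring) hsolve hF hprom hO
    rw [← hQ, ← hT] at hcount
    set bad := (Finset.univ.filter fun h : Fin ⌈(α : ℝ) * Real.log k⌉₊ → V →
      Fin ((β * k : ℕ+) : ℕ) =>
        ¬ IsMinHittingSet 𝓕 (solve ((unionOfSamples d (List.ofFn h)).output O))).card
    have hcores : ((Q : ℝ) * k) ^ d ≤ (k : ℝ) ^ ((Q + 1) * d) := by
      rw [pow_mul, pow_succ]
      gcongr
      have : Q ≤ (k : ℕ) ^ Q :=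
        Nat.lt_two_pow_self.le.trans (Nat.pow_le_pow_left hk Q)
      exact_mod_cast this
    have hpow : (k : ℝ) ^ c * (k : ℝ) ^ ((Q + 1) * d) ≤ 2 ^ ⌈(α : ℝ) * Real.log k⌉₊ := by
      have hlogk : 0 ≤ Real.log k := Real.log_nonneg (by exact_mod_cast k.pos)
      rw [← Real.rpow_natCast, ← Real.rpow_natCast, ← Real.rpow_add hk0,
        Real.rpow_def_of_pos hk0, Real.rpow_def_of_pos two_pos]
      refine Real.exp_le_exp.2 ?_
      calc _ ≤ Real.log k * (α * Real.log 2) := by gcongr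
        _ = Real.log 2 * (α * Real.log k) := by ring
        _ ≤ _ := by gcongr; exact Nat.le_ceil _
    have hreal : (bad : ℝ) * 2 ^ ⌈(α : ℝ) * Real.log k⌉₊ ≤ ((Q : ℝ) * k) ^ d * T := by
      exact_mod_cast hcount
    rw [one_div, ← div_eq_inv_mul, le_div_iff₀ (by positivity)]
    refine le_of_mul_le_mul_right ?_ (show (0 : ℝ) < (k : ℝ) ^ ((Q + 1) * d) by positivity)
    calc (bad : ℝ) * (k : ℝ) ^ c * (k : ℝ) ^ ((Q + 1) * d)
        = bad * ((k : ℝ) ^ c * (k : ℝ) ^ ((Q + 1) * d)) := by ring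
      _ ≤ bad * 2 ^ ⌈(α : ℝ) * Real.log k⌉₊ := by gcongr
      _ ≤ ((Q : ℝ) * k) ^ d * T := hreal
      _ ≤ (k : ℝ) ^ ((Q + 1) * d) * T := by gcongr
      _ = _ := by ring
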